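/- **Setting.** Let $\tilde V$ be a formal-analytic arithmetic surface over $\mathrm{Spec}\,\mathbb{Z}$ with formal part $\hat{\mathcal V}=\mathrm{Spf}\,\mathbb{Z}[[x]]$ and section $P$ given by the ideal $I=(x)$. Thus we are given a connected Riemann surface $V^+$, a compact connected domain $V\subset V^+$ with nonempty $C^\infty$ boundary, a point $O\in \mathring V$, an antiholomorphic involution $\sigma$ of $V^+$ that preserves $V$ and fixes $O$, and an isomorphism $\psi:\mathrm{Spf}\,\mathbb{C}[[x]]\to \hat V_{O}$ onto the formal completion of $V$ at $O$ (the gluing map), which intertwines complex conjugation of coefficients with $\sigma$. Let $\varphi=\psi^{-1}$, regarded as a formal function on $\hat V_O$ that vanishes at $O$. Let $g_{V,O}$ be the equilibrium Green's function of $V$ at $O$: it is continuous on $V^+\setminus\{O\}$, zero outside $\mathring V$, harmonic on $\mathring V\setminus\{O\}$, and $g_{V,O}-\log|z|^{-1}$ is bounded near $O$ for any local coordinate $z$ with $z(O)=0$. The capacitary norm $\|\cdot\|^{\mathrm{cap}}_{V,O}$ on $T_OV$ is the one with $\|\partial/\partial z\|^{\mathrm{cap}}_{V,O}=e^{-c}$,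 where $c=\lim_{w\to O}\bigl(g_{V,O}(w)-\log|z(w)|^{-1}\bigr)$; write $\|\cdot\|^{\mathrm{cap}}_{V,O}$ also for the dual norm on $T_OV^\vee$ and $\|\cdot\|^{\mathrm{cap},\otimes e}_{V,O}$ for the induced norm on $(T_OV^\vee)^{\otimes e}$. If a holomorphic or formal function near $O$ has expansion $\sum_{n\ge e}a_nz^n$, its $e$-th jet at $O$ is $\phi^{[e]}(O)=a_e\,dz(O)^{\otimes e}$. Let $P^*\overline N_P(\tilde V)$ be the normal bundle of $P$, that is, the $\mathbb{Z}$-module $(I/I^2)^\vee=\mathbb{Z}\,\partial/\partial x$ with the metric induced by the capacitary norm through $D\psi(0):\mathbb{C}\,\partial/\partial x\to T_OV$, and let $\widehat{\deg}$ be the Arakelov degree, $\widehat{\deg}(L,\|\cdot\|)=\log\#(L/\mathbb{Z}s)-\log\|s\|$ for any $0\ne s\in L$. The surface $\tilde V$ is called pseudoconvex if $\widehat{\deg}(P^*\overline N_P(\tilde V))<0$. **Proposition 3.9.** Let $f\in\mathbb{Z}[[x]]$ with $f(0)=0$ have vanishing order $e$ at $0$ and be monic, i.e. $f=x^e+\sum_{n>e}a_nx^n$.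 Let $\phi=f\circ\varphi$, a formal function on $\hat V_O$. Then $$\log\|\phi^{[e]}(O)\|^{\mathrm{cap},\otimes e}_{V,O}=e\,\widehat{\deg}\bigl(P^*\overline N_P(\tilde V)\bigr)=e\,\log\|d\varphi(O)\|^{\mathrm{cap}}_{V,O}.$$ In particular, if $\tilde V$ is pseudoconvex, then $\log\|\phi^{[e]}(O)\|^{\mathrm{cap},\otimes e}_{V,O}<0$. Moreover, if $\phi$ is the Taylor series at $O$ of a function, again called $\phi$, that is holomorphic on an open neighbourhood of $V$, then this function vanishes to order exactly $e$ at $O$, and the same formula and (for pseudoconvex $\tilde V$) the same inequality hold for its $e$-th jet at $O$. -/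

import Mathlib

open Set Filter Topology
open scoped Manifold ContDiff PowerSeries

noncomputable section

/-! ## Riemann surfaces with boundary -/

section RiemannSurface

variable {M : Type*} [TopologicalSpace M] [ChartedSpace ℂ M]

/-- `V` is a compact connected domain with nonempty `C^∞` boundary in the Riemann surface `M`
(the surface `V⁺` in which `V` is embedded): near each of its boundary points, `V` is a
sublevel set `{ρ ≤ 0}` of a `C^∞` real function with nonzero differential. -/
structure IsBorderedSurface (V : Set M) : Prop where
  isCompact : IsCompact V
  isConnected : IsConnected V
  boundary_nonempty : (frontier V).Nonempty
  smooth_boundary : ∀ p ∈ frontier V, ∃ (U : Set M) (ρ : M → ℝ), IsOpen U ∧ p ∈ U ∧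
    ContMDiffOn 𝓘(ℝ, ℂ) 𝓘(ℝ, ℝ) ∞ ρ U ∧ mfderiv 𝓘(ℝ, ℂ) 𝓘(ℝ, ℝ) ρ p ≠ 0 ∧
    V ∩ U = {q ∈ U | ρ q ≤ 0}

/-- `z` is a holomorphic local coordinate of `M` centered at `p`. -/
structure IsLocalCoordinate (z : OpenPartialHomeomorph M ℂ) (p : M) : Prop where
  mem_maximalAtlas : z ∈ IsManifold.maximalAtlas 𝓘(ℂ) ω M
  mem_source : p ∈ z.source
  map_eq_zero : z p = 0

/-- The real function `g` on `M` is harmonic near the point `p`. -/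
def HarmonicNear (g : M → ℝ) (p : M) : Prop :=
  InnerProductSpace.HarmonicAt (g ∘ (chartAt ℂ p).symm) (chartAt ℂ p p)

/-- The conditions that characterize the equilibrium Green's function of `V` at `O`, as a function
on `M` minus the point `O` (its value at `O` is irrelevant). -/
structure IsEquilibriumGreen (V : Set M) (O : M) (g : M → ℝ) : Prop where
  continuousOn : ContinuousOn g {O}ᶜ
  eq_zero : ∀ p ∉ interior V, g p = 0
  harmonic : ∀ p ∈ interior V \ {O}, HarmonicNear g p
  log_singularity : ∀ z : OpenPartialHomeomorph M ℂ, IsLocalCoordinate z O →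
    ∃ C : ℝ, ∀ᶠ w in 𝓝[≠] O, |g w - Real.log ‖z w‖⁻¹| ≤ C

/-- The equilibrium Green's function `g_{V,O}`: the function that satisfies `IsEquilibriumGreen`.-/
def equilibriumGreen (V : Set M) (O : M) : M → ℝ :=
  Classical.epsilon (IsEquilibriumGreen V O)

/-- The capacity `e^{-c}` of `V` at `O` with respect to the local coordinate `z`, where
`c = lim_{w → O} (g_{V,O}(w) - log |z(w)|⁻¹)`. -/
def capacity (V : Set M) (O : M) (z : OpenPartialHomeomorph M ℂ) : ℝ :=
  Real.exp (-limUnder (𝓝[≠] O) fun w => equilibriumGreen V O w - Real.log ‖z w‖⁻¹)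

/-- The differential `dz(p)` of the coordinate `z`, a linear form on the tangent line at `p`. -/
def coordDifferential (z : OpenPartialHomeomorph M ℂ) (p : M) :
    TangentSpace 𝓘(ℂ) p →L[ℂ] ℂ :=
  mfderiv 𝓘(ℂ) 𝓘(ℂ) z p

/-- The capacitary norm on the tangent line `T_O V`, for which `∂/∂z` has norm `capacity V O z`. -/
def capNorm (V : Set M) (O : M) (z : OpenPartialHomeomorph M ℂ) (v : TangentSpace 𝓘(ℂ) O) : ℝ :=
  capacity V O z * ‖coordDifferential z O v‖

/-- The norm on the cotangent line `(T_O V)^∨` dual to the capacitary norm. -/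
def capDualNorm (V : Set M) (O : M) (z : OpenPartialHomeomorph M ℂ)
    (α : TangentSpace 𝓘(ℂ) O →L[ℂ] ℂ) : ℝ :=
  sSup {r : ℝ | ∃ v, capNorm V O z v ≤ 1 ∧ r = ‖α v‖}

/-- The norm induced by the capacitary norm, by duality and tensor power, on the `e`-th tensor
power `((T_O V)^∨)^{⊗ e}`, realized as the space of `e`-linear forms on `T_O V`. -/
def capTensorNorm (V : Set M) (O : M) (z : OpenPartialHomeomorph M ℂ) {e : ℕ}
    (m : MultilinearMap ℂ (fun _ : Fin e => TangentSpace 𝓘(ℂ) O) ℂ) : ℝ :=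
  sSup {r : ℝ | ∃ v : Fin e → TangentSpace 𝓘(ℂ) O,
    (∀ i, capNorm V O z (v i) ≤ 1) ∧ r = ‖m v‖}

/-- The `e`-th jet `a_e dz(O)^{⊗ e}` of a formal function `∑_{n ≥ e} a_n z^n` on the formal
completion of `M` at `O` that vanishes to order at least `e`. -/
def formalJet (z : OpenPartialHomeomorph M ℂ) (O : M) (e : ℕ) (a : ℂ⟦X⟧) :
    MultilinearMap ℂ (fun _ : Fin e => TangentSpace 𝓘(ℂ) O) ℂ :=
  PowerSeries.coeff e a • (MultilinearMap.mkPiAlgebra ℂ (Fin e) ℂ).compLinearMap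
    fun _ => (coordDifferential z O).toLinearMap

/-- The differential at `O` of a formal function `∑ a_n z^n` on the formal completion of `M`
at `O`. -/
def formalDifferential (z : OpenPartialHomeomorph M ℂ) (O : M) (a : ℂ⟦X⟧) :
    TangentSpace 𝓘(ℂ) O →L[ℂ] ℂ :=
  PowerSeries.coeff 1 a • coordDifferential z O

/-- The Taylor series, in the local coordinate `z`, of a function `h` on `M` at the center of `z`,
that is, the image of `h` in the formal completion. -/
def taylorSeries (z : OpenPartialHomeomorph M ℂ) (h : M → ℂ) : ℂ⟦X⟧ :=
  PowerSeries.mk fun n => iteratedDeriv n (h ∘ z.symm) 0 / (n.factorial : ℂ)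

/-- `σ` is an antiholomorphic involution of `M`. -/
structure IsAntiholomorphicInvolution (σ : M → M) : Prop where
  involutive : Function.Involutive σ
  continuous : Continuous σ
  antiholomorphic : ∀ p, MDifferentiableAt 𝓘(ℂ) 𝓘(ℂ)
    (fun q => starRingEnd ℂ (chartAt ℂ (σ p) (σ q))) p

end RiemannSurface

/-! ## Arakelov degree over `Spec ℤ` -/

/-- The Arakelov degree of a Hermitian line bundle over `Spec ℤ`, given by a free `ℤ`-module `L` of
rank one and the norm on `L ⊂ L ⊗ ℂ`: the number `log #(L / ℤ s) - log ‖s‖`, where `s` is any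
nonzero element of `L`. -/
def arakelovDegree (L : Type*) [AddCommGroup L] (nrm : L → ℝ) : ℝ :=
  let s : L := Classical.epsilon fun s => s ≠ 0
  Real.log (Nat.card (L ⧸ AddSubgroup.zmultiples s)) - Real.log (nrm s)

/-- The Arakelov degree does not depend on the choice of the nonzero section. -/
theorem arakelovDegree_eq {L : Type*} [AddCommGroup L] (ε : L ≃+ ℤ) (nrm : L → ℝ)
    (hmul : ∀ (n : ℤ) (s : L), nrm (n • s) = |(n : ℝ)| * nrm s)
    (hne : ∀ s : L, s ≠ 0 → nrm s ≠ 0) (s : L) (hs : s ≠ 0) :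
    arakelovDegree L nrm =
      Real.log (Nat.card (L ⧸ AddSubgroup.zmultiples s)) - Real.log (nrm s) := by
  set u : L := ε.symm 1 with hu
  have key : ∀ t : L, t ≠ 0 →
      Real.log (Nat.card (L ⧸ AddSubgroup.zmultiples t)) - Real.log (nrm t)
        = -Real.log (nrm u) := by
    intro t ht
    have ht' : t = ε t • u := by
      apply ε.injective
      simp [hu]
    have hεt : ε t ≠ 0 := by simp [ht]
    have hu0 : u ≠ 0 := by
      intro h
      rw [h, smul_zero] at ht'
      exact ht ht'
    have hmap : (AddSubgroup.zmultiples t).map (ε : L →+ ℤ) = AddSubgroup.zmultiples (ε t) := by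
      exact AddMonoidHom.map_zmultiples (ε : L →+ ℤ) t
    have hcard : Nat.card (L ⧸ AddSubgroup.zmultiples t) = (ε t).natAbs := by
      rw [Nat.card_congr (QuotientAddGroup.congr _ _ ε hmap).toEquiv]
      exact Int.index_zmultiples (ε t)
    have hnrm : nrm t = |((ε t : ℤ) : ℝ)| * nrm u := by
      conv_lhs => rw [ht']
      exact hmul _ _
    rw [hcard, hnrm, Real.log_mul (by simpa using hεt) (hne u hu0), Nat.cast_natAbs,
      Int.cast_abs]
    ring
  have hex : ∃ t : L, t ≠ 0 := ⟨s, hs⟩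
  rw [key s hs]
  exact key _ (Classical.epsilon_spec hex)

/-! ## Formal-analytic arithmetic surfaces over `Spec ℤ` -/

/-- A formal-analytic arithmetic surface over `Spec ℤ`, with formal part `Spf ℤ⟦X⟧` (centered at
the section `P` of ideal `(X)`). Its analytic part is a Riemann surface with boundary `V ⊂ M = V⁺`
with a point `O` of the interior, the complex conjugation `σ`, and an isomorphism of formal curves
from `Spf ℂ⟦X⟧` to the formal completion of `M` at `O` that is compatible with the real structures.
Formal functions at `O` are written as power series in a local coordinate `z`, so that the
isomorphism is a power series `ψ` (the expression of `z` in terms of `X`), with compositional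
inverse `φ` (the expression of `X` in terms of `z`). -/
structure FormalAnalyticSurface (M : Type*) [TopologicalSpace M] [ChartedSpace ℂ M] where
  V : Set M
  bordered : IsBorderedSurface V
  O : M
  O_mem : O ∈ interior V
  σ : M → M
  σ_involution : IsAntiholomorphicInvolution σ
  σ_mapsTo : MapsTo σ V V
  σ_O : σ O = O
  z : OpenPartialHomeomorph M ℂ
  isLocalCoordinate : IsLocalCoordinate z O
  ψ : ℂ⟦X⟧
  φ : ℂ⟦X⟧
  ψ_zero : PowerSeries.constantCoeff ψ = 0
  φ_zero : PowerSeries.constantCoeff φ = 0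
  ψ_comp_φ : PowerSeries.subst φ ψ = (PowerSeries.X : ℂ⟦X⟧)
  φ_comp_ψ : PowerSeries.subst ψ φ = (PowerSeries.X : ℂ⟦X⟧)
  /-- The identity `σ ∘ ψ = ψ ∘ (complex conjugation)`, in the coordinate `z`. -/
  real : PowerSeries.subst ψ (taylorSeries z fun w => starRingEnd ℂ (z (σ w)))
    = PowerSeries.map (starRingEnd ℂ) ψ

namespace FormalAnalyticSurface

/-- The ideal `I = (X)` of `ℤ⟦X⟧` that defines the section `P`. -/
def sectionIdeal : Ideal ℤ⟦X⟧ := Ideal.span {PowerSeries.X}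

/-- The class of `X` in the conormal module `I / I²`. -/
def conormalX : sectionIdeal.Cotangent :=
  sectionIdeal.toCotangent ⟨PowerSeries.X, Ideal.subset_span rfl⟩

/-- The normal bundle of the section `P`, as a module over `ℤ = ℤ⟦X⟧ / I`: the dual of `I / I²`. -/
abbrev NormalModule : Type := sectionIdeal.Cotangent →ₗ[ℤ] ℤ

variable {M : Type*} [TopologicalSpace M] [ChartedSpace ℂ M] (S : FormalAnalyticSurface M)

/-- The tangent vector `Dψ(0)(∂/∂X)` at `O`, which is `ψ'(0) ∂/∂z`. -/
def gluingTangent : TangentSpace 𝓘(ℂ) S.O :=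
  (coordDifferential S.z S.O).inverse (PowerSeries.coeff 1 S.ψ)

/-- The embedding of the normal module `ℤ ∂/∂X` in the tangent line `T_O V` given by the
differential of the gluing map. -/
def normalToTangent (D : NormalModule) : TangentSpace 𝓘(ℂ) S.O :=
  ((D conormalX : ℤ) : ℂ) • S.gluingTangent

/-- The Arakelov degree of the normal bundle of `P`, equipped with the capacitary metric. -/
def normalDegree : ℝ :=
  arakelovDegree NormalModule fun D => capNorm S.V S.O S.z (S.normalToTangent D)

/-- Pseudoconvexity: the Arakelov degree of the normal bundle of `P` is negative. -/
def IsPseudoconvex : Prop := S.normalDegree < 0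

/-- The formal function `f ∘ φ` on the completion of `V` at `O`. -/
def pullback (f : ℤ⟦X⟧) : ℂ⟦X⟧ :=
  PowerSeries.subst S.φ (PowerSeries.map (Int.castRingHom ℂ) f)

end FormalAnalyticSurface

end

/-!
Write `c > 0` for the capacity of `V` at `O` in the coordinate `z`, and `φ₁`, `ψ₁` for the linear
coefficients of `φ` and `ψ`. All the norms in play are explicit multiples of absolute values of
coordinates:

* `‖a dz(O)^{⊗ e}‖ = |a| / c ^ e`, because `dz(O)` is an isomorphism `T_O V ≃ ℂ`
  (`capTensorNorm_formalJet`, and `capDualNorm_formalDifferential` on the cotangent line);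
* the normal module is `ℤ ∂/∂X`, and its generator has norm `c |ψ₁|`, so that its Arakelov degree is
  `-log (c |ψ₁|)` (`normalDegree_eq`).

Comparing linear coefficients in `ψ ∘ φ = X` gives `ψ₁ φ₁ = 1`, so the degree is `log (|φ₁| / c)`.
As `φ` vanishes at `O` and `f = X ^ e + ⋯`, the leading coefficient of `f ∘ φ` is `φ₁ ^ e`
(`coeff_pullback`), whose jet has norm `(|φ₁| / c) ^ e`. This is the formula. A holomorphic function
near `V` whose Taylor series is `f ∘ φ` is analytic at `O` in the coordinate `z`, so its order of
vanishing is read off from the Taylor coefficients.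

The capacity enters only through its positivity.
-/

/-! ### Composition of power series -/

section PowerSeries

open PowerSeries

variable {R : Type*} [CommRing R]

/-- Substitution into a series that is divisible by `X ^ e`: the factor `X ^ e` becomes `φ ^ e`,
which is again divisible by `X ^ e` since `φ` has no constant term. -/
theorem PowerSeries.exists_subst_X_pow_mul {φ : R⟦X⟧} (hφ : constantCoeff φ = 0) (e : ℕ)
    (g : R⟦X⟧) :
    ∃ h : R⟦X⟧, subst φ (X ^ e * g) = X ^ e * h ∧
      constantCoeff h = coeff 1 φ ^ e * constantCoeff g := by
  have hs : HasSubst φ := HasSubst.of_constantCoeff_zero' hφ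
  obtain ⟨u, rfl⟩ := X_dvd_iff.2 hφ
  refine ⟨u ^ e * subst (X * u) g, ?_, ?_⟩
  · rw [subst_mul hs, subst_pow hs, subst_X hs, mul_pow, mul_assoc]
  · obtain ⟨k, hk⟩ := X_dvd_iff.2 (show constantCoeff (g - C (constantCoeff g)) = 0 by simp)
    have hg : g = C (constantCoeff g) + X * k := by rw [← hk]; ring
    have hc : constantCoeff (subst (X * u) g) = constantCoeff g := by
      conv_lhs => rw [hg]
      rw [subst_add hs, subst_mul hs, subst_X hs, subst_C]
      change constantCoeff (C (constantCoeff g) + X * u * subst (X * u) k) = _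
      simp
    have h1 : coeff 1 (X * u) = constantCoeff u := by
      simp
    rw [map_mul, map_pow, hc, h1]

theorem PowerSeries.coeff_one_subst {φ ψ : R⟦X⟧} (hφ : constantCoeff φ = 0)
    (hψ : constantCoeff ψ = 0) : coeff 1 (subst φ ψ) = coeff 1 ψ * coeff 1 φ := by
  obtain ⟨u, rfl⟩ := X_dvd_iff.2 hψ
  obtain ⟨h, hh, hc⟩ := exists_subst_X_pow_mul hφ 1 u
  rw [pow_one] at hh hc
  have key (w : R⟦X⟧) : coeff 1 (X * w) = constantCoeff w := by simp
  rw [hh, key, hc, key, mul_comm]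

end PowerSeries

/-! ### Coordinates and capacitary norms -/

section CapacitaryNorm

variable {M : Type*} [TopologicalSpace M] [ChartedSpace ℂ M]

theorem IsLocalCoordinate.isInvertible_coordDifferential [IsManifold 𝓘(ℂ) ω M]
    {z : OpenPartialHomeomorph M ℂ} {p : M} (hz : IsLocalCoordinate z p) :
    (coordDifferential z p).IsInvertible := by
  have : IsManifold 𝓘(ℂ) 1 M := IsManifold.of_le (n := ω) le_top
  have hd : z.MDifferentiable 𝓘(ℂ) 𝓘(ℂ) :=
    ⟨(contMDiffOn_of_mem_maximalAtlas hz.mem_maximalAtlas).mdifferentiableOn (by simp),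
      (contMDiffOn_symm_of_mem_maximalAtlas hz.mem_maximalAtlas).mdifferentiableOn (by simp)⟩
  exact ⟨hd.mfderiv hz.mem_source, rfl⟩

theorem capacity_pos (V : Set M) (O : M) (z : OpenPartialHomeomorph M ℂ) :
    0 < capacity V O z :=
  Real.exp_pos _

/-- A tangent vector of capacitary norm one. -/
theorem exists_capacity_mul_norm_eq_one (V : Set M) {O : M} {z : OpenPartialHomeomorph M ℂ}
    (hd : (coordDifferential z O).IsInvertible) :
    ∃ v, ‖coordDifferential z O v‖ = (capacity V O z)⁻¹ := by
  refine ⟨(coordDifferential z O).inverse ((capacity V O z)⁻¹ : ℝ), ?_⟩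
  rw [hd.self_apply_inverse, Complex.norm_real, Real.norm_eq_abs,
    abs_of_pos (inv_pos.2 (capacity_pos V O z))]

theorem norm_coordDifferential_le {V : Set M} {O : M} {z : OpenPartialHomeomorph M ℂ}
    {v : TangentSpace 𝓘(ℂ) O} (hv : capNorm V O z v ≤ 1) :
    ‖coordDifferential z O v‖ ≤ (capacity V O z)⁻¹ := by
  rw [← one_div, le_div_iff₀' (capacity_pos V O z)]
  exact hv

theorem capNorm_le_one {V : Set M} {O : M} {z : OpenPartialHomeomorph M ℂ}
    {v : TangentSpace 𝓘(ℂ) O} (hv : ‖coordDifferential z O v‖ = (capacity V O z)⁻¹) :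
    capNorm V O z v ≤ 1 := by
  rw [capNorm, hv, mul_inv_cancel₀ (capacity_pos V O z).ne']

theorem capDualNorm_formalDifferential (V : Set M) {O : M} {z : OpenPartialHomeomorph M ℂ}
    (hd : (coordDifferential z O).IsInvertible) (a : ℂ⟦X⟧) :
    capDualNorm V O z (formalDifferential z O a)
      = ‖PowerSeries.coeff 1 a‖ * (capacity V O z)⁻¹ := by
  refine IsGreatest.csSup_eq ⟨?_, ?_⟩
  · obtain ⟨v, hv⟩ := exists_capacity_mul_norm_eq_one V hd
    refine ⟨v, capNorm_le_one hv, ?_⟩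
    rw [← hv, ← norm_mul]
    rfl
  · rintro _ ⟨v, hv, rfl⟩
    refine (norm_mul (PowerSeries.coeff 1 a) (coordDifferential z O v)).le.trans ?_
    gcongr
    exact norm_coordDifferential_le hv

theorem norm_formalJet_apply {z : OpenPartialHomeomorph M ℂ} {O : M} {e : ℕ} (a : ℂ⟦X⟧)
    (v : Fin e → TangentSpace 𝓘(ℂ) O) :
    ‖formalJet z O e a v‖ = ‖PowerSeries.coeff e a‖ * ∏ i, ‖coordDifferential z O (v i)‖ := by
  rw [← norm_prod, ← norm_mul]
  simp [formalJet]

theorem capTensorNorm_formalJet (V : Set M) {O : M} {z : OpenPartialHomeomorph M ℂ}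
    (hd : (coordDifferential z O).IsInvertible) (e : ℕ) (a : ℂ⟦X⟧) :
    capTensorNorm V O z (formalJet z O e a)
      = ‖PowerSeries.coeff e a‖ * (capacity V O z)⁻¹ ^ e := by
  refine IsGreatest.csSup_eq ⟨?_, ?_⟩
  · obtain ⟨v, hv⟩ := exists_capacity_mul_norm_eq_one V hd
    refine ⟨fun _ => v, fun _ => capNorm_le_one hv, ?_⟩
    simp [norm_formalJet_apply, hv]
  · rintro _ ⟨v, hv, rfl⟩
    rw [norm_formalJet_apply]
    gcongr
    calc ∏ i, ‖coordDifferential z O (v i)‖ ≤ ∏ _i : Fin e, (capacity V O z)⁻¹ :=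
          Finset.prod_le_prod (fun _ _ => norm_nonneg _)
            fun i _ => norm_coordDifferential_le (hv i)
      _ = (capacity V O z)⁻¹ ^ e := by simp

end CapacitaryNorm

namespace FormalAnalyticSurface

/-! ### The normal module -/

theorem mem_sectionIdeal {x : ℤ⟦X⟧} :
    x ∈ sectionIdeal ↔ PowerSeries.constantCoeff x = 0 := by
  rw [sectionIdeal, Ideal.mem_span_singleton, PowerSeries.X_dvd_iff]

theorem mem_sectionIdeal_sq {x : ℤ⟦X⟧} :
    x ∈ sectionIdeal ^ 2 ↔ PowerSeries.X ^ 2 ∣ x := by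
  rw [sectionIdeal, Ideal.span_singleton_pow, Ideal.mem_span_singleton]

/-- Modulo `I²`, an element of `I = (X)` is its linear coefficient times `X`. -/
theorem toCotangent_eq_zsmul_conormalX (x : sectionIdeal) :
    sectionIdeal.toCotangent x
      = (PowerSeries.coeff 1 (x : ℤ⟦X⟧) : ℤ) • conormalX := by
  have h : sectionIdeal.toCotangent x = sectionIdeal.toCotangent
      ((PowerSeries.coeff 1 (x : ℤ⟦X⟧) : ℤ) • ⟨PowerSeries.X, Ideal.subset_span rfl⟩) := by
    rw [Ideal.toCotangent_eq, mem_sectionIdeal_sq, PowerSeries.X_pow_dvd_iff]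
    intro m hm
    have h0 := mem_sectionIdeal.1 x.2
    interval_cases m
    · simp [h0]
    · simp
  rw [h, map_zsmul]
  rfl

/-- The linear form on `I / I²` dual to `X`, that is, `∂/∂X`. -/
theorem exists_normalModule_apply_conormalX : ∃ D : NormalModule, D conormalX = 1 := by
  let q : sectionIdeal →+ sectionIdeal.Cotangent := sectionIdeal.toCotangent.toAddMonoidHom
  let c : sectionIdeal →+ ℤ :=
    (PowerSeries.coeff (R := ℤ) 1).toAddMonoidHom.comp
      sectionIdeal.subtype.toAddMonoidHom
  have hq : Function.Surjective q := sectionIdeal.toCotangent_surjective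
  have hker : q.ker ≤ c.ker := by
    intro x hx
    have hx2 : (x : ℤ⟦X⟧) ∈ sectionIdeal ^ 2 := (sectionIdeal.toCotangent_eq_zero x).1 hx
    exact PowerSeries.X_pow_dvd_iff.1 (mem_sectionIdeal_sq.1 hx2) 1 one_lt_two
  let D := q.liftOfSurjective hq ⟨c, hker⟩
  refine ⟨D.toIntLinearMap, ?_⟩
  have hD : D conormalX = c ⟨PowerSeries.X, Ideal.subset_span rfl⟩ :=
    q.liftOfRightInverse_comp_apply _ _ ⟨c, hker⟩ _
  refine hD.trans ?_
  change PowerSeries.coeff 1 (PowerSeries.X : ℤ⟦X⟧) = 1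
  simp

/-- The normal module is free of rank one: a normal vector is determined by its value on the class
of `X`. -/
noncomputable def normalEquiv : NormalModule ≃+ ℤ :=
  AddEquiv.ofBijective (LinearMap.applyₗ (R := ℤ) conormalX).toAddMonoidHom (by
    constructor
    · intro D D' h
      refine LinearMap.ext fun y => ?_
      obtain ⟨x, rfl⟩ := sectionIdeal.toCotangent_surjective y
      rw [toCotangent_eq_zsmul_conormalX, map_zsmul, map_zsmul]
      exact congrArg _ h
    · intro n
      obtain ⟨D, hD⟩ := exists_normalModule_apply_conormalX
      refine ⟨n • D, ?_⟩
      change (n • D) conormalX = n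
      simp [hD])

theorem normalEquiv_apply (D : NormalModule) : normalEquiv D = D conormalX := rfl

variable {M : Type*} [TopologicalSpace M] [ChartedSpace ℂ M] (S : FormalAnalyticSurface M)

theorem coeff_one_ψ_mul_coeff_one_φ :
    PowerSeries.coeff 1 S.ψ * PowerSeries.coeff 1 S.φ = 1 := by
  rw [← PowerSeries.coeff_one_subst S.φ_zero S.ψ_zero, S.ψ_comp_φ, PowerSeries.coeff_one_X]

theorem coeff_one_φ_ne_zero : PowerSeries.coeff 1 S.φ ≠ 0 :=
  right_ne_zero_of_mul_eq_one S.coeff_one_ψ_mul_coeff_one_φ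

theorem capNorm_normalToTangent (hd : (coordDifferential S.z S.O).IsInvertible)
    (D : NormalModule) :
    capNorm S.V S.O S.z (S.normalToTangent D)
      = |((D conormalX : ℤ) : ℝ)| * (capacity S.V S.O S.z * ‖PowerSeries.coeff 1 S.ψ‖) := by
  rw [capNorm, normalToTangent, map_smul, gluingTangent, hd.self_apply_inverse, norm_smul,
    Complex.norm_intCast]
  ring

theorem normalDegree_eq (hd : (coordDifferential S.z S.O).IsInvertible) :
    S.normalDegree
      = Real.log (‖PowerSeries.coeff 1 S.φ‖ * (capacity S.V S.O S.z)⁻¹) := by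
  have hψ : PowerSeries.coeff 1 S.ψ ≠ 0 :=
    left_ne_zero_of_mul_eq_one S.coeff_one_ψ_mul_coeff_one_φ
  have hpos : 0 < capacity S.V S.O S.z * ‖PowerSeries.coeff 1 S.ψ‖ :=
    mul_pos (capacity_pos _ _ _) (norm_pos_iff.2 hψ)
  obtain ⟨D, hD⟩ := exists_normalModule_apply_conormalX
  have hD0 : D ≠ 0 := by
    rintro rfl
    simp at hD
  have htop : AddSubgroup.zmultiples D = ⊤ := by
    refine (AddSubgroup.eq_top_iff' _).2 fun D' => ⟨D' conormalX, ?_⟩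
    apply normalEquiv.injective
    change normalEquiv (D' conormalX • D) = normalEquiv D'
    rw [map_zsmul, normalEquiv_apply, normalEquiv_apply, hD]
    simp
  have hcard : Nat.card (NormalModule ⧸ AddSubgroup.zmultiples D) = 1 := by
    change (AddSubgroup.zmultiples D).index = 1
    rw [htop, AddSubgroup.index_top]
  have hmul : ∀ (n : ℤ) (s : NormalModule), capNorm S.V S.O S.z (S.normalToTangent (n • s))
      = |(n : ℝ)| * capNorm S.V S.O S.z (S.normalToTangent s) := by
    intro n s
    rw [S.capNorm_normalToTangent hd, S.capNorm_normalToTangent hd, ← normalEquiv_apply,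
      map_zsmul, smul_eq_mul, Int.cast_mul, abs_mul, mul_assoc, normalEquiv_apply]
  have hne : ∀ s : NormalModule, s ≠ 0 → capNorm S.V S.O S.z (S.normalToTangent s) ≠ 0 := by
    intro s hs
    rw [S.capNorm_normalToTangent hd]
    refine mul_ne_zero (abs_ne_zero.2 (Int.cast_ne_zero.2 ?_)) hpos.ne'
    rw [← normalEquiv_apply]
    simpa using hs
  rw [normalDegree, arakelovDegree_eq normalEquiv _ hmul hne D hD0, hcard,
    S.capNorm_normalToTangent hd, hD, eq_inv_of_mul_eq_one_right S.coeff_one_ψ_mul_coeff_one_φ,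
    norm_inv, ← mul_inv, Real.log_inv, mul_comm ‖_‖]
  simp

/-! ### Leading terms of pullbacks -/

/-- For monic `f` of order `e`, the series `f ∘ φ` has leading term `φ₁ ^ e z ^ e`. -/
theorem coeff_pullback {f : ℤ⟦X⟧} {e : ℕ} (hf : f.order = e)
    (hmonic : PowerSeries.coeff e f = 1) :
    (∀ n < e, PowerSeries.coeff n (S.pullback f) = 0) ∧
      PowerSeries.coeff e (S.pullback f) = PowerSeries.coeff 1 S.φ ^ e := by
  obtain ⟨g, rfl⟩ : PowerSeries.X ^ e ∣ f :=
    PowerSeries.X_pow_dvd_iff.2 fun m hm =>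
      PowerSeries.coeff_of_lt_order m (by rw [hf]; exact_mod_cast hm)
  have hg : PowerSeries.constantCoeff g = 1 := by
    rw [← hmonic, PowerSeries.coeff_X_pow_mul']
    simp
  obtain ⟨h, hh, hc⟩ := PowerSeries.exists_subst_X_pow_mul S.φ_zero e
    (PowerSeries.map (Int.castRingHom ℂ) g)
  have hp : S.pullback (PowerSeries.X ^ e * g) = PowerSeries.X ^ e * h := by
    rw [pullback, map_mul, map_pow, PowerSeries.map_X, hh]
  rw [hp]
  refine ⟨PowerSeries.X_pow_dvd_iff.1 (dvd_mul_right _ _), ?_⟩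
  rw [PowerSeries.coeff_X_pow_mul', if_pos le_rfl, Nat.sub_self,
    PowerSeries.coeff_zero_eq_constantCoeff_apply, hc,
    ← PowerSeries.coeff_zero_eq_constantCoeff_apply, PowerSeries.coeff_map,
    PowerSeries.coeff_zero_eq_constantCoeff_apply, hg]
  simp

theorem log_capTensorNorm_formalJet_pullback (hd : (coordDifferential S.z S.O).IsInvertible)
    {f : ℤ⟦X⟧} {e : ℕ} (hf : f.order = e) (hmonic : PowerSeries.coeff e f = 1) :
    Real.log (capTensorNorm S.V S.O S.z (formalJet S.z S.O e (S.pullback f)))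
      = e * S.normalDegree := by
  rw [capTensorNorm_formalJet _ hd, (S.coeff_pullback hf hmonic).2, norm_pow, ← mul_pow,
    Real.log_pow, S.normalDegree_eq hd]

end FormalAnalyticSurface

/-! ### Holomorphic functions -/

theorem IsLocalCoordinate.analyticAt_comp_symm {M : Type*} [TopologicalSpace M]
    [ChartedSpace ℂ M] [IsManifold 𝓘(ℂ) ω M]
    {z : OpenPartialHomeomorph M ℂ} {p : M} (hz : IsLocalCoordinate z p) {U : Set M}
    (hU : IsOpen U) (hp : p ∈ U) {h : M → ℂ} (hh : MDifferentiableOn 𝓘(ℂ) 𝓘(ℂ) h U) :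
    AnalyticAt ℂ (h ∘ z.symm) 0 := by
  have hzs : MDifferentiableOn 𝓘(ℂ) 𝓘(ℂ) z.symm z.target :=
    (contMDiffOn_symm_of_mem_maximalAtlas hz.mem_maximalAtlas).mdifferentiableOn (by simp)
  have hW : IsOpen (z.target ∩ z.symm ⁻¹' U) := z.isOpen_inter_preimage_symm hU
  have h0 : (0 : ℂ) ∈ z.target ∩ z.symm ⁻¹' U := by
    rw [← hz.map_eq_zero]
    refine ⟨z.map_source hz.mem_source, ?_⟩
    rwa [mem_preimage, z.left_inv hz.mem_source]
  have hd : MDifferentiableOn 𝓘(ℂ) 𝓘(ℂ) (h ∘ z.symm) (z.target ∩ z.symm ⁻¹' U) :=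
    hh.comp (hzs.mono inter_subset_left) inter_subset_right
  exact (mdifferentiableOn_iff_differentiableOn.1 hd).analyticAt (hW.mem_nhds h0)

theorem analyticOrderAt_comp_symm_eq {M : Type*} [TopologicalSpace M]
    {z : OpenPartialHomeomorph M ℂ} {h : M → ℂ}
    (ha : AnalyticAt ℂ (h ∘ z.symm) 0) {e : ℕ}
    (hlt : ∀ n < e, PowerSeries.coeff n (taylorSeries z h) = 0)
    (hne : PowerSeries.coeff e (taylorSeries z h) ≠ 0) :
    analyticOrderAt (h ∘ z.symm) 0 = e := by
  simp only [taylorSeries, PowerSeries.coeff_mk] at hlt hne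
  refine (analyticOrderAt_eq_nat_iff_iteratedDeriv_eq_zero ha).2
    ⟨fun k hk => ?_, fun h0 => ?_⟩
  · exact (div_eq_zero_iff.1 (hlt k hk)).resolve_right (by exact_mod_cast k.factorial_ne_zero)
  · exact hne (by rw [h0, zero_div])

theorem proposition3p9 {M : Type*} [TopologicalSpace M] [T2Space M] [ConnectedSpace M]
    [ChartedSpace ℂ M] [IsManifold 𝓘(ℂ) ω M] (S : FormalAnalyticSurface M)
    (f : ℤ⟦X⟧) (e : ℕ) (hf₀ : PowerSeries.constantCoeff f = 0) (hf : f.order = e)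
    (hmonic : PowerSeries.coeff e f = 1) :
    Real.log (capTensorNorm S.V S.O S.z (formalJet S.z S.O e (S.pullback f)))
        = e * S.normalDegree ∧
    e * S.normalDegree
        = e * Real.log (capDualNorm S.V S.O S.z (formalDifferential S.z S.O S.φ)) ∧
    (S.IsPseudoconvex →
      Real.log (capTensorNorm S.V S.O S.z (formalJet S.z S.O e (S.pullback f))) < 0) ∧
    -- the case of a holomorphic function `ϕ` near `V` whose germ at `O` is `f ∘ φ`
    ∀ (U : Set M) (ϕ : M → ℂ), IsOpen U → S.V ⊆ U → MDifferentiableOn 𝓘(ℂ) 𝓘(ℂ) ϕ U →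
      taylorSeries S.z ϕ = S.pullback f →
      analyticOrderAt (ϕ ∘ S.z.symm) 0 = e ∧
      Real.log (capTensorNorm S.V S.O S.z (formalJet S.z S.O e (taylorSeries S.z ϕ)))
        = e * S.normalDegree ∧
      (S.IsPseudoconvex →
        Real.log (capTensorNorm S.V S.O S.z (formalJet S.z S.O e (taylorSeries S.z ϕ))) < 0) := by
  have hd := S.isLocalCoordinate.isInvertible_coordDifferential
  have hlog := S.log_capTensorNorm_formalJet_pullback hd hf hmonic
  have he : e ≠ 0 := by
    rintro rfl
    rw [PowerSeries.coeff_zero_eq_constantCoeff_apply, hf₀] at hmonic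
    exact zero_ne_one hmonic
  have hneg : S.IsPseudoconvex →
      Real.log (capTensorNorm S.V S.O S.z (formalJet S.z S.O e (S.pullback f))) < 0 := by
    intro hS
    rw [hlog]
    exact mul_neg_of_pos_of_neg (by exact_mod_cast he.bot_lt) hS
  refine ⟨hlog, ?_, hneg, ?_⟩
  · rw [capDualNorm_formalDifferential _ hd, S.normalDegree_eq hd]
  · intro U ϕ hU hVU hϕ hT
    rw [hT]
    obtain ⟨hlt, hcoeff⟩ := S.coeff_pullback hf hmonic
    refine ⟨analyticOrderAt_comp_symm_eq
      (S.isLocalCoordinate.analyticAt_comp_symm hU (hVU (interior_subset S.O_mem)) hϕ)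
      (hT ▸ hlt) ?_, hlog, hneg⟩
    rw [hT, hcoeff]
    exact pow_ne_zero _ S.coeff_one_φ_ne_zero
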